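/- Let $(\Omega,\mathcal A,P)$ be a probability space. Let $g:[0,1]\to[0,1]$ be a distortion function, i.e. increasing and right-continuous with $\lim_{u\nearrow 1}g(u)=g(1)=1$; integrals $\int_0^1 f\,\mathrm dg$ are taken over $[0,1]$ with respect to the Borel probability measure $\mu_g$ given by $\mu_g([0,u])=g(u)$, $u\in[0,1]$. Let $\phi:[0,\infty)\to[0,\infty)$ be a normalized Young function, i.e. convex with $\phi(0)=0$, $\lim_{t\to\infty}\phi(t)=\infty$ and $\phi(1)=1$; put $\phi(\infty)=\infty$. For a real random variable $X$ on $\Omega$ with distribution function $F_X$ let $F_X^{-1}(u)=\inf\{x\in\mathbb R: F_X(x)\ge u\}\in[-\infty,\infty]$. Let $L_g^\phi$ be the set of all real random variables $X$ with $\int_0^1\phi\big(|F_X^{-1}(1-u)|/a\big)\,\mathrm dg(u)<\infty$ for some $a>0$. For $X\ge 0$ in $L_g^\phi$ define $$\pi_{g,\phi,0}(X)=\inf\Big\{a>0:\int_0^1\phi\Big(\frac{F_X^{-1}(1-u)}{a}\Big)\,\mathrm dg(u)\le 1\Big\},$$ and for $X\in L_g^\phi$ define $$\rho_{g,\phi,0}(X)=\inf_{x\in\mathbb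 R}\big(\pi_{g,\phi,0}((X-x)^+)+x\big).$$ Let $X\in L_g^\phi$; then $(X-x)^+\in L_g^\phi$ for every $x\in\mathbb R$, and the following hold. (a) The map $x\mapsto \pi_{g,\phi,0}((X-x)^+)+x$ is increasing (in the weak sense) on $\mathbb R$, and $\rho_{g,\phi,0}(X)=\lim_{x\to-\infty}\big(\pi_{g,\phi,0}((X-x)^+)+x\big)$, a real number. (b) Suppose in addition that $g$ is continuous with $g(0)=0$ and $g>0$ on $(0,1]$, that $\phi$ is strictly convex and satisfies the $\Delta_2$-condition (there are $s\ge 0$ and $K>0$ with $\phi(2t)\le K\phi(t)$ for all $t\ge s$), and that $P(X=\mathrm{ess\,sup}\,X)=0$, where $\mathrm{ess\,sup}\,X\in(-\infty,\infty]$. Then this map is strictly increasing on $\mathbb R$. In particular, it does not attain its infimum $\rho_{g,\phi,0}(X)$. -/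

import Mathlib

open MeasureTheory ProbabilityTheory Set Filter Topology
open scoped ENNReal unitInterval

/-- A distortion function: an increasing, right-continuous map `g : [0,1] → [0,1]` with
`lim_{u ↗ 1} g u = g 1 = 1`. The value `g 0` may be positive. -/
structure DistortionFunction where
  toFun : I → I
  monotone' : Monotone toFun
  rightContinuous' : ∀ u, ContinuousWithinAt toFun (Ici u) u
  tendsto_one' : Tendsto toFun (𝓝[<] 1) (𝓝 1)
  map_one' : toFun 1 = 1

namespace DistortionFunction

instance : CoeFun DistortionFunction fun _ => I → I := ⟨toFun⟩

/-- The extension of `g` to the real line by `0` on `(-∞, 0)` and by `1` on `(1, ∞)`. -/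
noncomputable def stieltjes (g : DistortionFunction) : StieltjesFunction ℝ where
  toFun x := if x < 0 then 0 else (g (projIcc 0 1 zero_le_one x) : ℝ)
  mono' := by
    intro x y hxy
    dsimp only
    split_ifs with hx hy hy
    · exact le_rfl
    · exact (g _).2.1
    · exact absurd (hxy.trans_lt hy) hx
    · exact g.monotone' (monotone_projIcc _ hxy)
  right_continuous' := by
    intro x
    rcases lt_or_ge x 0 with hx | hx
    · refine ContinuousAt.continuousWithinAt ?_
      refine (continuousAt_const (y := (0 : ℝ))).congr ?_
      filter_upwards [Iio_mem_nhds hx] with y hy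
      exact (if_pos hy).symm
    · have h1 : ContinuousWithinAt
          (fun y : ℝ => (g (projIcc 0 1 zero_le_one y) : ℝ)) (Ici x) x := by
        have h2 := (g.rightContinuous' (projIcc 0 1 zero_le_one x)).comp
          (continuous_projIcc (h := zero_le_one' ℝ)).continuousWithinAt
          (fun y (hy : y ∈ Ici x) => monotone_projIcc (zero_le_one' ℝ) hy)
        exact continuous_subtype_val.continuousAt.comp_continuousWithinAt h2
      refine h1.congr (fun y hy => if_neg (not_lt.2 (hx.trans hy))) (if_neg (not_lt.2 hx))

/-- The Borel probability measure `μ_g`, carried by `[0,1]`, with `μ_g [0,u] = g u` for all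
`u ∈ [0,1]`; in particular it has mass `g 0` at the point `0`. -/
noncomputable def measure (g : DistortionFunction) : Measure ℝ := g.stieltjes.measure

end DistortionFunction

/-- A Young function: a convex function `φ : [0,∞) → [0,∞)` with `φ 0 = 0` and `φ t → ∞` as
`t → ∞`. The values of `φ` at negative numbers are irrelevant throughout. -/
structure IsYoungFunction (φ : ℝ → ℝ) : Prop where
  nonneg : ∀ t, 0 ≤ t → 0 ≤ φ t
  convexOn : ConvexOn ℝ (Ici 0) φ
  map_zero : φ 0 = 0
  tendsto_atTop : Tendsto φ atTop atTop

/-- The Young function `φ` is normalized. -/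
def IsNormalized (φ : ℝ → ℝ) : Prop := φ 1 = 1

/-- The `Δ₂`-condition: `φ (2 t) ≤ K φ t` for all sufficiently large `t`. -/
def SatisfiesDeltaTwo (φ : ℝ → ℝ) : Prop :=
  ∃ s K : ℝ, 0 ≤ s ∧ 0 < K ∧ ∀ t, s ≤ t → φ (2 * t) ≤ K * φ t

/-- The extension of a Young function to `[0,∞]` by `φ ∞ = ∞`. -/
noncomputable def youngExtend (φ : ℝ → ℝ) (t : ℝ≥0∞) : ℝ≥0∞ :=
  if t = ∞ then ∞ else ENNReal.ofReal (φ t.toReal)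

section Risk

variable {Ω : Type*} [MeasurableSpace Ω]

/-- The quantile function `F_X⁻¹ u = inf {x ∈ ℝ | F_X x ≥ u}`, with values in `[-∞,∞]`;
thus `F_X⁻¹ 0 = -∞`, and `F_X⁻¹ 1 = ∞` when `X` is not essentially bounded above. -/
noncomputable def quantile (P : Measure Ω) (X : Ω → ℝ) (u : ℝ) : EReal :=
  sInf ((fun x : ℝ => (x : EReal)) '' {x : ℝ | u ≤ cdf (P.map X) x})

/-- The integral `∫_{[0,1]} φ (|F_X⁻¹ (1 - u)| / a) dg(u)`, for `a > 0`. For `X ≥ 0` the absolute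
value is superfluous, as `F_X⁻¹ (1 - u) ≥ 0` for `0 ≤ u < 1` and `μ_g {1} = 0`. -/
noncomputable def orliczLorentzModular (P : Measure Ω) (g : DistortionFunction) (φ : ℝ → ℝ)
    (X : Ω → ℝ) (a : ℝ) : ℝ≥0∞ :=
  ∫⁻ u in Icc (0 : ℝ) 1,
    youngExtend φ ((quantile P X (1 - u)).abs / ENNReal.ofReal a) ∂g.measure

/-- The space `L_g^φ` of all random variables `X` with
`∫_{[0,1]} φ (|F_X⁻¹ (1 - u)| / a) dg(u) < ∞` for some `a > 0`. -/
def orliczLorentzSpace (P : Measure Ω) (g : DistortionFunction) (φ : ℝ → ℝ) : Set (Ω → ℝ) :=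
  {X | Measurable X ∧ ∃ a : ℝ, 0 < a ∧ orliczLorentzModular P g φ X a < ∞}

/-- The Orlicz-Lorentz premium `π_{g,φ,α} X`, for positive `X` in `L_g^φ` and `α < 1`. -/
noncomputable def orliczLorentzPremium (P : Measure Ω) (g : DistortionFunction) (φ : ℝ → ℝ)
    (α : ℝ) (X : Ω → ℝ) : ℝ :=
  sInf {a : ℝ | 0 < a ∧ orliczLorentzModular P g φ X a ≤ ENNReal.ofReal (1 - α)}

/-- The distortion Haezendonck-Goovaerts risk measure
`ρ_{g,φ,α} X = inf_{x ∈ ℝ} (π_{g,φ,α} ((X - x)⁺) + x)`, for `X` in `L_g^φ` and `0 ≤ α < 1`. -/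
noncomputable def distortionHG (P : Measure Ω) (g : DistortionFunction) (φ : ℝ → ℝ)
    (α : ℝ) (X : Ω → ℝ) : ℝ :=
  ⨅ x : ℝ, (orliczLorentzPremium P g φ α (fun ω => max (X ω - x) 0) + x)

end Risk

/-! Write `f u` for the quantile `F_X⁻¹ (1 - u)`, a real random variable under `μ_g`. The quantile
transform commutes with `t ↦ (t - x)⁺`, so the premium of `(X - x)⁺` is the Luxemburg norm `N x` of
`(f - x)⁺`, and everything reduces to one function on a probability space.

Since `φ 1 = 1`, a constant `c > 0` has norm `c`. For `x < y`, the triangle inequality applied to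
`(f - x)⁺ ≤ (f - y)⁺ + (y - x)` gives `N x + x ≤ N y + y`. For `x ≤ 0`, applied to `-x ≤ (f - x)⁺ +
|f|`, it bounds `N x + x` below. Hence the limit at `-∞` is the infimum.

For strictness let `b = N y` and `c = y - x`. Under `Δ₂` the modular is finite at every scale, so
for `b > 0` the scale `b` is itself admissible, and a modular below 1 at scale `b + c` forces `N x <
b + c`. Strict convexity yields such a modular unless `f = y + b` a.e.; for `b = 0` it suffices that
`f < y` a.e. Both cases rest on `f` not attaining its essential supremum with positive measure,
inherited from `X` in `ae_lt_of_ae_le_upperQuantile`. -/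

/-! ### Convexity inequalities for Young functions -/

namespace IsYoungFunction

variable {φ : ℝ → ℝ}

theorem map_mul_le (hφ : IsYoungFunction φ) {l t : ℝ} (hl : 0 ≤ l) (hl1 : l ≤ 1) (ht : 0 ≤ t) :
    φ (l * t) ≤ l * φ t := by
  have h := hφ.convexOn.2 (mem_Ici.2 ht) (mem_Ici.2 le_rfl) hl (sub_nonneg.2 hl1) (by ring)
  simpa [hφ.map_zero] using h

theorem mono (hφ : IsYoungFunction φ) {s t : ℝ} (hs : 0 ≤ s) (hst : s ≤ t) : φ s ≤ φ t := by
  rcases hs.eq_or_lt with rfl | hs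
  · rw [hφ.map_zero]
    exact hφ.nonneg t hst
  have ht : 0 < t := hs.trans_le hst
  have h1 : s / t ≤ 1 := (div_le_one ht).2 hst
  have h := hφ.map_mul_le (div_nonneg hs.le ht.le) h1 ht.le
  rw [div_mul_cancel₀ _ ht.ne'] at h
  exact h.trans (mul_le_of_le_one_left (hφ.nonneg t ht.le) h1)

theorem map_add_le (hφ : IsYoungFunction φ) {a b s t : ℝ} (ha : 0 < a) (hb : 0 < b)
    (hs : 0 ≤ s) (ht : 0 ≤ t) :
    φ ((s + t) / (a + b)) ≤ a / (a + b) * φ (s / a) + b / (a + b) * φ (t / b) := by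
  have hab : 0 < a + b := add_pos ha hb
  have h := hφ.convexOn.2 (mem_Ici.2 (div_nonneg hs ha.le)) (mem_Ici.2 (div_nonneg ht hb.le))
    (div_nonneg ha.le hab.le) (div_nonneg hb.le hab.le) (by field_simp)
  have e : a / (a + b) * (s / a) + b / (a + b) * (t / b) = (s + t) / (a + b) := by field_simp
  simpa only [smul_eq_mul, e] using h

theorem le_map (hφ : IsYoungFunction φ) (hφ1 : IsNormalized φ) {t : ℝ} (ht : 1 ≤ t) :
    t ≤ φ t := by
  have ht0 : 0 < t := zero_lt_one.trans_le ht
  have h := hφ.map_mul_le (inv_nonneg.2 ht0.le) (inv_le_one_of_one_le₀ ht) ht0.le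
  rw [inv_mul_cancel₀ ht0.ne', hφ1, inv_mul_eq_div, le_div_iff₀ ht0, one_mul] at h
  exact h

theorem measurable_comp (hφ : IsYoungFunction φ) {α : Type*} [MeasurableSpace α] {h : α → ℝ}
    (hm : Measurable h) (h0 : ∀ u, 0 ≤ h u) : Measurable fun u => φ (h u) := by
  -- Nothing is known about `φ` on negative numbers, so monotonicity is available only after
  -- truncation at 0.
  have hmono : Monotone fun t => φ (max t 0) := fun s t hst =>
    hφ.mono (le_max_right _ _) (max_le_max_right 0 hst)
  simpa [Function.comp_def, h0] using hmono.measurable.comp hm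

theorem monotone_youngExtend (hφ : IsYoungFunction φ) : Monotone (youngExtend φ) := by
  intro s t hst
  unfold youngExtend
  split_ifs with hs ht ht
  · exact le_rfl
  · exact absurd (top_le_iff.1 (hs ▸ hst)) ht
  · exact le_top
  · exact ENNReal.ofReal_le_ofReal
      (hφ.mono ENNReal.toReal_nonneg (ENNReal.toReal_mono ht hst))

end IsYoungFunction

/-! ### Luxemburg norms and their modulars -/

section Luxemburg

variable {α : Type*} [MeasurableSpace α]

/-- The integral of `φ (h / a)`. -/
noncomputable def luxemburgModular (ν : Measure α) (φ : ℝ → ℝ) (h : α → ℝ) (a : ℝ) : ℝ≥0∞ :=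
  ∫⁻ u, ENNReal.ofReal (φ (h u / a)) ∂ν

/-- The scales `a` that are admissible in the definition of the Luxemburg norm of `h`. -/
def luxemburgSet (ν : Measure α) (φ : ℝ → ℝ) (h : α → ℝ) : Set ℝ :=
  {a | 0 < a ∧ luxemburgModular ν φ h a ≤ 1}

/-- The Luxemburg norm of a nonnegative function. -/
noncomputable def luxemburgNorm (ν : Measure α) (φ : ℝ → ℝ) (h : α → ℝ) : ℝ :=
  sInf (luxemburgSet ν φ h)

variable {ν : Measure α} {φ : ℝ → ℝ} {h k : α → ℝ}

theorem bddBelow_luxemburgSet : BddBelow (luxemburgSet ν φ h) := ⟨0, fun _ ha => ha.1.le⟩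

theorem luxemburgNorm_nonneg : 0 ≤ luxemburgNorm ν φ h := Real.sInf_nonneg fun _ ha => ha.1.le

/-- Convexity of the modular, as a bound transferred from the integrands. -/
theorem luxemburgModular_le_of_convex_bound (hφ : IsYoungFunction φ) {h₁ h₂ : α → ℝ} {a a₁ a₂ s t : ℝ}
    (hm₁ : Measurable h₁) (h₁0 : ∀ u, 0 ≤ h₁ u) (ha₁ : 0 < a₁) (hs : 0 ≤ s) (ht : 0 ≤ t)
    (hle : ∀ u, φ (h u / a) ≤ s * φ (h₁ u / a₁) + t * φ (h₂ u / a₂)) :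
    luxemburgModular ν φ h a ≤ ENNReal.ofReal s * luxemburgModular ν φ h₁ a₁ +
      ENNReal.ofReal t * luxemburgModular ν φ h₂ a₂ := by
  have hm := hφ.measurable_comp (hm₁.div_const a₁) fun u => div_nonneg (h₁0 u) ha₁.le
  unfold luxemburgModular
  rw [← lintegral_const_mul' _ _ ENNReal.ofReal_ne_top,
    ← lintegral_const_mul' _ _ ENNReal.ofReal_ne_top,
    ← lintegral_add_left (hm.ennreal_ofReal.const_mul _)]
  refine lintegral_mono fun u => ?_
  rw [← ENNReal.ofReal_mul hs, ← ENNReal.ofReal_mul ht]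
  exact (ENNReal.ofReal_le_ofReal (hle u)).trans ENNReal.ofReal_add_le

/-- The triangle inequality at the level of admissible scales, by convexity with weights `a / (a +
b)` and `b / (a + b)`. Working with scales avoids asking whether the norms are attained. -/
theorem add_mem_luxemburgSet (hφ : IsYoungFunction φ) {h₁ h₂ : α → ℝ} {a b : ℝ}
    (hm₁ : Measurable h₁) (h0 : ∀ u, 0 ≤ h u) (h₁0 : ∀ u, 0 ≤ h₁ u) (h₂0 : ∀ u, 0 ≤ h₂ u)
    (hle : ∀ u, h u ≤ h₁ u + h₂ u)
    (ha : a ∈ luxemburgSet ν φ h₁) (hb : b ∈ luxemburgSet ν φ h₂) :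
    a + b ∈ luxemburgSet ν φ h := by
  have ha0 := ha.1
  have hb0 := hb.1
  have hab : 0 < a + b := add_pos ha0 hb0
  refine ⟨hab, (luxemburgModular_le_of_convex_bound hφ hm₁ h₁0 ha0 (s := a / (a + b))
    (t := b / (a + b)) (h₂ := h₂) (a₂ := b) (by positivity) (by positivity) fun u => ?_).trans ?_⟩
  · exact (hφ.mono (div_nonneg (h0 u) hab.le) (by gcongr; exact hle u)).trans
      (hφ.map_add_le ha0 hb0 (h₁0 u) (h₂0 u))
  · calc _ ≤ ENNReal.ofReal (a / (a + b)) * 1 + ENNReal.ofReal (b / (a + b)) * 1 := by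
          gcongr
          · exact ha.2
          · exact hb.2
      _ = 1 := by
          rw [mul_one, mul_one, ← ENNReal.ofReal_add (by positivity) (by positivity), ← add_div,
            div_self hab.ne', ENNReal.ofReal_one]

theorem luxemburgModular_const [IsProbabilityMeasure ν] (c a : ℝ) :
    luxemburgModular ν φ (fun _ => c) a = ENNReal.ofReal (φ (c / a)) := by
  simp [luxemburgModular]

theorem const_mem_luxemburgSet [IsProbabilityMeasure ν] (hφ1 : IsNormalized φ) {c : ℝ}
    (hc : 0 < c) : c ∈ luxemburgSet ν φ (fun _ => c) := by
  refine ⟨hc, ?_⟩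
  rw [luxemburgModular_const, div_self hc.ne', hφ1, ENNReal.ofReal_one]

theorem le_of_mem_luxemburgSet_const [IsProbabilityMeasure ν] (hφ : IsYoungFunction φ)
    (hφ1 : IsNormalized φ) {c a : ℝ} (ha : a ∈ luxemburgSet ν φ (fun _ => c)) : c ≤ a := by
  by_contra! hac
  have h1 : 1 < c / a := (one_lt_div ha.1).2 hac
  have h2 := ha.2
  rw [luxemburgModular_const, ENNReal.ofReal_le_one] at h2
  exact absurd (hφ.le_map hφ1 h1.le) (by linarith)

theorem luxemburgSet_nonempty (hφ : IsYoungFunction φ) (h0 : ∀ u, 0 ≤ h u) {a : ℝ} (ha : 0 < a)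
    (hfin : luxemburgModular ν φ h a < ∞) : (luxemburgSet ν φ h).Nonempty := by
  -- Since `φ (t / c) ≤ φ t / c` for `c ≥ 1`, enlarging the scale by this factor brings the modular
  -- down to at most 1.
  set c : ℝ := max 1 (luxemburgModular ν φ h a).toReal with hc
  have hc1 : 1 ≤ c := le_max_left _ _
  have hc0 : 0 < c := zero_lt_one.trans_le hc1
  refine ⟨c * a, by positivity, ?_⟩
  calc luxemburgModular ν φ h (c * a)
      ≤ ∫⁻ u, ENNReal.ofReal c⁻¹ * ENNReal.ofReal (φ (h u / a)) ∂ν := by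
        refine lintegral_mono fun u => ?_
        rw [← ENNReal.ofReal_mul (by positivity)]
        refine ENNReal.ofReal_le_ofReal ?_
        have := hφ.map_mul_le (inv_nonneg.2 hc0.le) (inv_le_one_of_one_le₀ hc1)
          (div_nonneg (h0 u) ha.le)
        convert this using 2
        field_simp
    _ = ENNReal.ofReal c⁻¹ * luxemburgModular ν φ h a :=
        lintegral_const_mul' _ _ ENNReal.ofReal_ne_top
    _ ≤ ENNReal.ofReal c⁻¹ * ENNReal.ofReal c := by
        gcongr
        rw [← ENNReal.ofReal_toReal hfin.ne]
        exact ENNReal.ofReal_le_ofReal (le_max_right _ _)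
    _ = 1 := by
        rw [← ENNReal.ofReal_mul (by positivity), inv_mul_cancel₀ hc0.ne', ENNReal.ofReal_one]

theorem luxemburgModular_antitone (hφ : IsYoungFunction φ) (h0 : ∀ u, 0 ≤ h u) {a b : ℝ}
    (ha : 0 < a) (hab : a ≤ b) : luxemburgModular ν φ h b ≤ luxemburgModular ν φ h a := by
  refine lintegral_mono fun u => ENNReal.ofReal_le_ofReal ?_
  exact hφ.mono (div_nonneg (h0 u) (ha.trans_le hab).le) (by gcongr; exact h0 u)

theorem mem_luxemburgSet_of_norm_lt (hφ : IsYoungFunction φ) (h0 : ∀ u, 0 ≤ h u)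
    (hne : (luxemburgSet ν φ h).Nonempty) {a : ℝ} (ha : luxemburgNorm ν φ h < a) :
    a ∈ luxemburgSet ν φ h := by
  obtain ⟨b, hb, hba⟩ := exists_lt_of_csInf_lt hne ha
  exact ⟨hb.1.trans hba, (luxemburgModular_antitone hφ h0 hb.1 hba.le).trans hb.2⟩

theorem luxemburgModular_half_lt_top [IsFiniteMeasure ν] (hφ : IsYoungFunction φ)
    (hΔ : SatisfiesDeltaTwo φ) (h0 : ∀ u, 0 ≤ h u) {a : ℝ} (ha : 0 < a)
    (hfin : luxemburgModular ν φ h a < ∞) : luxemburgModular ν φ h (a / 2) < ∞ := by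
  obtain ⟨s, K, hs, hK, hsK⟩ := hΔ
  calc luxemburgModular ν φ h (a / 2)
      ≤ ∫⁻ u, (ENNReal.ofReal K * ENNReal.ofReal (φ (h u / a)) + ENNReal.ofReal (φ (2 * s))) ∂ν := by
        refine lintegral_mono fun u => ?_
        have hu : 0 ≤ h u / a := div_nonneg (h0 u) ha.le
        have e : h u / (a / 2) = 2 * (h u / a) := by field_simp
        rw [← ENNReal.ofReal_mul hK.le, ← ENNReal.ofReal_add
          (mul_nonneg hK.le (hφ.nonneg _ hu)) (hφ.nonneg _ (by positivity)), e]
        refine ENNReal.ofReal_le_ofReal ?_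
        -- `Δ₂` applies only above `s`; below it the integrand is at most `φ (2 * s)`, integrable
        -- because `ν` is finite.
        rcases le_total s (h u / a) with hsu | hsu
        · linarith [hsK _ hsu, hφ.nonneg (2 * s) (by positivity)]
        · have := hφ.mono (by positivity : 0 ≤ 2 * (h u / a)) (by linarith : _ ≤ 2 * s)
          linarith [mul_nonneg hK.le (hφ.nonneg _ hu)]
    _ = ENNReal.ofReal K * luxemburgModular ν φ h a + ENNReal.ofReal (φ (2 * s)) * ν univ := by
        rw [lintegral_add_right _ measurable_const,
          lintegral_const_mul' _ _ ENNReal.ofReal_ne_top, lintegral_const]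
        rfl
    _ < ∞ := ENNReal.add_lt_top.2 ⟨ENNReal.mul_lt_top ENNReal.ofReal_lt_top hfin,
        ENNReal.mul_lt_top ENNReal.ofReal_lt_top (measure_lt_top _ _)⟩

/-- Under `Δ₂`, the modular is finite at every scale. -/
theorem luxemburgModular_lt_top [IsFiniteMeasure ν] (hφ : IsYoungFunction φ)
    (hΔ : SatisfiesDeltaTwo φ) (h0 : ∀ u, 0 ≤ h u) (hne : (luxemburgSet ν φ h).Nonempty) {a : ℝ}
    (ha : 0 < a) : luxemburgModular ν φ h a < ∞ := by
  obtain ⟨b, hb, hb1⟩ := hne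
  have hn : ∀ n : ℕ, luxemburgModular ν φ h (b / 2 ^ n) < ∞ := by
    intro n
    induction n with
    | zero => simpa using hb1.trans_lt ENNReal.one_lt_top
    | succ n ih =>
      have := luxemburgModular_half_lt_top hφ hΔ h0 (by positivity) ih
      rwa [div_div, ← pow_succ] at this
  obtain ⟨n, hn'⟩ := pow_unbounded_of_one_lt (b / a) one_lt_two
  refine (luxemburgModular_antitone hφ h0 (by positivity) ?_).trans_lt (hn n)
  rw [div_le_iff₀ (by positivity)]
  rw [div_lt_iff₀ ha] at hn'
  linarith

/-- The Luxemburg norm is admissible, when it is positive and the modular is finite. -/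
theorem luxemburgModular_norm_le_one (hφ : IsYoungFunction φ) (hm : Measurable h)
    (h0 : ∀ u, 0 ≤ h u) (hne : (luxemburgSet ν φ h).Nonempty)
    (hpos : 0 < luxemburgNorm ν φ h)
    (hfin : luxemburgModular ν φ h (luxemburgNorm ν φ h / 2) < ∞) :
    luxemburgModular ν φ h (luxemburgNorm ν φ h) ≤ 1 := by
  set b := luxemburgNorm ν φ h with hb
  set C := luxemburgModular ν φ h (b / 2) with hC
  have key : ∀ l : ℝ, 0 < l → l < 1 / 2 →
      luxemburgModular ν φ h b ≤ 1 + ENNReal.ofReal l * C := by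
    intro l hl hl2
    have hd : 0 < 1 - 2 * l := by linarith
    -- The scale `a` on the right solves `1 / b = (1 - l) / a + l / (b / 2)`. It exceeds the norm,
    -- hence is admissible, and convexity bounds the modular at `b`; then `l → 0`.
    have ha : b < b * (1 - l) / (1 - 2 * l) := by
      rw [lt_div_iff₀ hd]
      nlinarith
    have haS := mem_luxemburgSet_of_norm_lt hφ h0 hne ha
    refine (luxemburgModular_le_of_convex_bound hφ hm h0 haS.1 (s := 1 - l) (t := l) (h₂ := h)
      (a₂ := b / 2) (by linarith) hl.le fun u => ?_).trans ?_
    · have := hφ.convexOn.2 (mem_Ici.2 (div_nonneg (h0 u) haS.1.le))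
        (mem_Ici.2 (div_nonneg (h0 u) (half_pos hpos).le)) (by linarith : 0 ≤ 1 - l) hl.le (by ring)
      have h1l : 1 - l ≠ 0 := by linarith
      have e : (1 - l) * (h u / (b * (1 - l) / (1 - 2 * l))) + l * (h u / (b / 2)) = h u / b := by
        field_simp
        ring
      simpa only [smul_eq_mul, e] using this
    · gcongr
      calc ENNReal.ofReal (1 - l) * _ ≤ 1 * 1 :=
            mul_le_mul' (ENNReal.ofReal_le_one.2 (by linarith)) haS.2
        _ = 1 := one_mul 1
  have hlim : Tendsto (fun l : ℝ => 1 + ENNReal.ofReal l * C) (𝓝[>] 0) (𝓝 (1 + 0 * C)) := by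
    refine Tendsto.const_add _ (ENNReal.Tendsto.mul_const ?_ (Or.inr hfin.ne))
    have := (ENNReal.continuous_ofReal.tendsto 0).mono_left (nhdsWithin_le_nhds (s := Ioi 0))
    simpa using this
  rw [zero_mul, add_zero] at hlim
  refine ge_of_tendsto hlim ?_
  filter_upwards [Ioo_mem_nhdsGT (by norm_num : (0 : ℝ) < 1 / 2)] with l hl
  exact key l hl.1 hl.2

/-- The Luxemburg norm is below every scale at which the modular is less than one. -/
theorem luxemburgNorm_lt (hφ : IsYoungFunction φ) (hm : Measurable h) (h0 : ∀ u, 0 ≤ h u)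
    {a : ℝ} (ha : 0 < a) (hlt : luxemburgModular ν φ h a < 1)
    (hfin : luxemburgModular ν φ h (a / 2) < ∞) : luxemburgNorm ν φ h < a := by
  set C := luxemburgModular ν φ h (a / 2) with hC
  have hlim : Tendsto (fun l : ℝ => luxemburgModular ν φ h a + ENNReal.ofReal l * C) (𝓝[>] 0)
      (𝓝 (luxemburgModular ν φ h a + 0 * C)) := by
    refine Tendsto.const_add _ (ENNReal.Tendsto.mul_const ?_ (Or.inr hfin.ne))
    have := (ENNReal.continuous_ofReal.tendsto 0).mono_left (nhdsWithin_le_nhds (s := Ioi 0))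
    simpa using this
  rw [zero_mul, add_zero] at hlim
  obtain ⟨l, hl1, hl0, hl⟩ := ((hlim.eventually (gt_mem_nhds hlt)).and
    (Ioo_mem_nhdsGT (zero_lt_one' ℝ))).exists
  -- A scale below `a`, chosen so that `(1 + l) / a = (1 - l) / a + l / (a / 2)`.
  have hmem : a / (1 + l) ∈ luxemburgSet ν φ h := by
    refine ⟨by positivity, ?_⟩
    refine (luxemburgModular_le_of_convex_bound hφ hm h0 ha (s := 1 - l) (t := l) (h₂ := h)
      (a₂ := a / 2) (by linarith) hl0.le fun u => ?_).trans (le_trans ?_ hl1.le)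
    · have := hφ.convexOn.2 (mem_Ici.2 (div_nonneg (h0 u) ha.le))
        (mem_Ici.2 (div_nonneg (h0 u) (half_pos ha).le)) (by linarith : 0 ≤ 1 - l) hl0.le (by ring)
      have e : (1 - l) * (h u / a) + l * (h u / (a / 2)) = h u / (a / (1 + l)) := by
        field_simp
        ring
      simpa only [smul_eq_mul, e] using this
    · gcongr
      exact mul_le_of_le_one_left' (ENNReal.ofReal_le_one.2 (by linarith))
  refine (csInf_le bddBelow_luxemburgSet hmem).trans_lt ?_
  rw [div_lt_iff₀ (by positivity)]
  nlinarith

/-- From `t ≤ φ t + 1` one gets `∫ h ≤ a * (modular + 1) ≤ 2 * a` for every `a > 0`. -/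
theorem ae_eq_zero_of_luxemburgNorm_eq_zero [IsProbabilityMeasure ν] (hφ : IsYoungFunction φ)
    (hφ1 : IsNormalized φ) (hm : Measurable h) (h0 : ∀ u, 0 ≤ h u)
    (hne : (luxemburgSet ν φ h).Nonempty) (hz : luxemburgNorm ν φ h = 0) : h =ᵐ[ν] 0 := by
  have key : ∀ a : ℝ, 0 < a → ∫⁻ u, ENNReal.ofReal (h u) ∂ν ≤ ENNReal.ofReal a * 2 := by
    intro a ha
    have haS := mem_luxemburgSet_of_norm_lt hφ h0 hne (hz ▸ ha)
    calc ∫⁻ u, ENNReal.ofReal (h u) ∂ν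
        ≤ ∫⁻ u, ENNReal.ofReal a * (ENNReal.ofReal (φ (h u / a)) + 1) ∂ν := by
          refine lintegral_mono fun u => ?_
          have hu : 0 ≤ h u / a := div_nonneg (h0 u) ha.le
          rw [← ENNReal.ofReal_one, ← ENNReal.ofReal_add (hφ.nonneg _ hu) zero_le_one,
            ← ENNReal.ofReal_mul ha.le]
          refine ENNReal.ofReal_le_ofReal ?_
          rw [← div_le_iff₀' ha]
          rcases le_total 1 (h u / a) with h1 | h1
          · linarith [hφ.le_map hφ1 h1]
          · linarith [hφ.nonneg _ hu]
      _ = ENNReal.ofReal a * (luxemburgModular ν φ h a + 1) := by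
          rw [lintegral_const_mul' _ _ ENNReal.ofReal_ne_top,
            lintegral_add_right _ measurable_const, lintegral_const, measure_univ, one_mul]
          rfl
      _ ≤ ENNReal.ofReal a * 2 := by
          gcongr
          rw [← one_add_one_eq_two]
          gcongr
          exact haS.2
  have hlim : Tendsto (fun a : ℝ => ENNReal.ofReal a * 2) (𝓝[>] 0) (𝓝 (0 * 2)) := by
    refine ENNReal.Tendsto.mul_const ?_ (Or.inr (by norm_num))
    have := (ENNReal.continuous_ofReal.tendsto 0).mono_left (nhdsWithin_le_nhds (s := Ioi 0))
    simpa using this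
  rw [zero_mul] at hlim
  have hint : ∫⁻ u, ENNReal.ofReal (h u) ∂ν = 0 := by
    refine le_antisymm (ge_of_tendsto hlim ?_) zero_le
    filter_upwards [self_mem_nhdsWithin] with a ha
    exact key a ha
  rw [lintegral_eq_zero_iff hm.ennreal_ofReal] at hint
  filter_upwards [hint] with u hu
  exact le_antisymm (ENNReal.ofReal_eq_zero.1 hu) (h0 u)

/-- An almost everywhere strict inequality between integrands bounds an integral strictly. -/
theorem luxemburgModular_lt_one {a : ℝ} {r : α → ℝ} (hr : Measurable r)
    (hle : ∀ᵐ u ∂ν, φ (h u / a) ≤ r u) (hr1 : ∫⁻ u, ENNReal.ofReal (r u) ∂ν ≤ 1)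
    (hφ0 : ∀ u, 0 ≤ φ (h u / a))
    (hne : ¬ ∀ᵐ u ∂ν, φ (h u / a) = r u) : luxemburgModular ν φ h a < 1 := by
  by_contra! hge
  refine hne ?_
  have hle' : (fun u => ENNReal.ofReal (φ (h u / a))) ≤ᵐ[ν] fun u => ENNReal.ofReal (r u) := by
    filter_upwards [hle] with u hu using ENNReal.ofReal_le_ofReal hu
  have hfin : luxemburgModular ν φ h a ≠ ∞ :=
    ((lintegral_mono_ae hle').trans (hr1.trans le_rfl)).trans_lt ENNReal.one_lt_top |>.ne
  have heq := ae_eq_of_ae_le_of_lintegral_le hle' hfin hr.ennreal_ofReal.aemeasurable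
    (hr1.trans hge)
  filter_upwards [heq, hle] with u hu hu'
  exact (ENNReal.ofReal_eq_ofReal_iff (hφ0 u) ((hφ0 u).trans hu')).1 hu

end Luxemburg

/-! ### The shifted norm as a function of the shift -/

section Shift

variable {α : Type*} [MeasurableSpace α] {ν : Measure α} [IsProbabilityMeasure ν] {φ : ℝ → ℝ}
  {f : α → ℝ}

theorem luxemburgSet_shift_nonempty (hφ : IsYoungFunction φ) (hφ1 : IsNormalized φ)
    (hf : Measurable f) (hne : (luxemburgSet ν φ fun u => |f u|).Nonempty) (x : ℝ) :
    (luxemburgSet ν φ fun u => max (f u - x) 0).Nonempty := by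
  obtain ⟨a, ha⟩ := hne
  refine ⟨a + (|x| + 1), add_mem_luxemburgSet hφ hf.abs (fun u => le_max_right _ _)
    (fun u => abs_nonneg _) (fun _ => by positivity) (fun u => ?_) ha
    (const_mem_luxemburgSet hφ1 (c := |x| + 1) (by positivity))⟩
  refine max_le ?_ (by positivity)
  linarith [le_abs_self (f u), neg_abs_le x]

theorem luxemburgNorm_shift_mono (hφ : IsYoungFunction φ) (hφ1 : IsNormalized φ)
    (hf : Measurable f) (hne : (luxemburgSet ν φ fun u => |f u|).Nonempty) :
    Monotone fun x : ℝ => luxemburgNorm ν φ (fun u => max (f u - x) 0) + x := by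
  intro x y hxy
  rcases hxy.eq_or_lt with rfl | hxy
  · exact le_rfl
  have h : luxemburgNorm ν φ (fun u => max (f u - x) 0) - (y - x) ≤
      luxemburgNorm ν φ (fun u => max (f u - y) 0) := by
    refine le_csInf (luxemburgSet_shift_nonempty hφ hφ1 hf hne y) fun a ha => ?_
    rw [sub_le_iff_le_add]
    refine csInf_le bddBelow_luxemburgSet (add_mem_luxemburgSet hφ
      ((hf.sub_const y).max measurable_const) (fun u => le_max_right _ _)
      (fun u => le_max_right _ _) (fun _ => (sub_pos.2 hxy).le) (fun u => ?_) ha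
      (const_mem_luxemburgSet hφ1 (sub_pos.2 hxy)))
    refine max_le ?_ (add_nonneg (le_max_right _ _) (sub_pos.2 hxy).le)
    linarith [le_max_left (f u - y) 0]
  dsimp only
  linarith

theorem luxemburgNorm_shift_bddBelow (hφ : IsYoungFunction φ) (hφ1 : IsNormalized φ)
    (hf : Measurable f) (hne : (luxemburgSet ν φ fun u => |f u|).Nonempty) :
    BddBelow (range fun x : ℝ => luxemburgNorm ν φ (fun u => max (f u - x) 0) + x) := by
  have hne' := hne
  obtain ⟨b, hb⟩ := hne'
  -- Any admissible scale `b` of `|f|` serves: for `x ≤ 0`, adding it to a scale of `(f - x)⁺` gives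
  -- a scale of the constant `-x`.
  refine ⟨-b, ?_⟩
  rintro _ ⟨x, rfl⟩
  have hb0 := hb.1
  dsimp only
  rcases le_total 0 x with hx | hx
  · linarith [luxemburgNorm_nonneg (ν := ν) (φ := φ) (h := fun u => max (f u - x) 0)]
  · have h : -x - b ≤ luxemburgNorm ν φ (fun u => max (f u - x) 0) := by
      refine le_csInf (luxemburgSet_shift_nonempty hφ hφ1 hf hne x) fun a ha => ?_
      have := le_of_mem_luxemburgSet_const hφ hφ1 (c := -x) (add_mem_luxemburgSet hφ
        ((hf.sub_const x).max measurable_const) (fun _ => neg_nonneg.2 hx)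
        (fun u => le_max_right _ _) (fun u => abs_nonneg (f u)) (fun u => ?_) ha hb)
      · linarith
      · linarith [le_max_left (f u - x) 0, neg_abs_le (f u)]
    linarith

/-- If `f` does not attain its essential supremum on a set of positive measure, then the shifted
norm is strictly increasing in the shift. -/
theorem luxemburgNorm_shift_strictMono (hφ : IsYoungFunction φ) (hφ1 : IsNormalized φ)
    (hf : Measurable f) (hne : (luxemburgSet ν φ fun u => |f u|).Nonempty)
    (hconv : StrictConvexOn ℝ (Ici 0) φ) (hΔ : SatisfiesDeltaTwo φ)
    (hsup : ∀ k : ℝ, (∀ᵐ u ∂ν, f u ≤ k) → ∀ᵐ u ∂ν, f u < k) :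
    StrictMono fun x : ℝ => luxemburgNorm ν φ (fun u => max (f u - x) 0) + x := by
  intro x y hxy
  set c := y - x with hc
  have hc0 : 0 < c := sub_pos.2 hxy
  have hmeas : ∀ z, Measurable fun u => max (f u - z) 0 := fun z =>
    (hf.sub_const z).max measurable_const
  have hnn : ∀ z u, 0 ≤ max (f u - z) 0 := fun z u => le_max_right _ _
  have hneS := luxemburgSet_shift_nonempty hφ hφ1 hf hne
  set b := luxemburgNorm ν φ (fun u => max (f u - y) 0) with hb
  have hb0 : 0 ≤ b := luxemburgNorm_nonneg
  have hbc : 0 < b + c := by linarith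
  have hle : ∀ u, max (f u - x) 0 ≤ max (f u - y) 0 + c := fun u =>
    max_le (by linarith [le_max_left (f u - y) 0]) (by linarith [le_max_right (f u - y) 0])
  suffices hlt : luxemburgModular ν φ (fun u => max (f u - x) 0) (b + c) < 1 by
    have := luxemburgNorm_lt hφ (hmeas x) (hnn x) hbc hlt
      (luxemburgModular_lt_top hφ hΔ (hnn x) (hneS x) (half_pos hbc))
    dsimp only
    linarith
  have hφ0 : ∀ u, 0 ≤ φ (max (f u - x) 0 / (b + c)) := fun u =>
    hφ.nonneg _ (div_nonneg (hnn x u) hbc.le)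
  rcases hb0.eq_or_lt with hb0 | hb0
  -- If `b = 0`, then `f ≤ y` a.e., hence `f < y` a.e., so `(f - x)⁺ < c` and the integrand stays
  -- below `φ 1 = 1`.
  · have hz := ae_eq_zero_of_luxemburgNorm_eq_zero hφ hφ1 (hmeas y) (hnn y) (hneS y) hb0.symm
    have hlt := hsup y (by
      filter_upwards [hz] with u hu
      have : max (f u - y) 0 = 0 := hu
      linarith [le_max_left (f u - y) 0])
    have hstrict : ∀ᵐ u ∂ν, φ (max (f u - x) 0 / (b + c)) < 1 := by
      filter_upwards [hlt] with u hu
      have h1 : max (f u - x) 0 / (b + c) < 1 := by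
        rw [div_lt_one hbc, ← hb0, zero_add]
        exact max_lt (by linarith) hc0
      have h2 := hφ.map_mul_le (div_nonneg (hnn x u) hbc.le) h1.le zero_le_one
      rw [mul_one, hφ1, mul_one] at h2
      exact h2.trans_lt h1
    refine luxemburgModular_lt_one (r := fun _ => 1) measurable_const
      (hstrict.mono fun u hu => hu.le) (by simp) hφ0 fun hall => ?_
    obtain ⟨u, hu, hu'⟩ := (hstrict.and hall).exists
    exact hu.ne hu'
  · have hb1 := luxemburgModular_norm_le_one hφ (hmeas y) (hnn y) (hneS y) hb0
      (luxemburgModular_lt_top hφ hΔ (hnn y) (hneS y) (half_pos hb0))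
    have hmy : Measurable fun u => φ (max (f u - y) 0 / b) :=
      hφ.measurable_comp ((hmeas y).div_const _) fun u => div_nonneg (hnn y u) hb0.le
    have hpt : ∀ u, φ (max (f u - x) 0 / (b + c)) ≤ φ ((max (f u - y) 0 + c) / (b + c)) :=
      fun u => hφ.mono (div_nonneg (hnn x u) hbc.le) (by gcongr; exact hle u)
    have hcc : φ (c / c) = 1 := by rw [div_self hc0.ne', hφ1]
    refine luxemburgModular_lt_one
      (r := fun u => b / (b + c) * φ (max (f u - y) 0 / b) + c / (b + c))
      ((hmy.const_mul _).add_const _) (ae_of_all _ fun u => ?_) ?_ hφ0 fun hall => ?_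
    · have := hφ.map_add_le hb0 hc0 (hnn y u) hc0.le
      rw [hcc, mul_one] at this
      exact (hpt u).trans this
    · calc ∫⁻ u, ENNReal.ofReal (b / (b + c) * φ (max (f u - y) 0 / b) + c / (b + c)) ∂ν
          = ∫⁻ u, (ENNReal.ofReal (b / (b + c)) * ENNReal.ofReal (φ (max (f u - y) 0 / b)) +
              ENNReal.ofReal (c / (b + c))) ∂ν := by
            refine lintegral_congr fun u => ?_
            have := hφ.nonneg _ (div_nonneg (hnn y u) hb0.le)
            rw [ENNReal.ofReal_add (by positivity) (by positivity),
              ENNReal.ofReal_mul (by positivity)]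
        _ = ENNReal.ofReal (b / (b + c)) * luxemburgModular ν φ (fun u => max (f u - y) 0) b +
              ENNReal.ofReal (c / (b + c)) := by
            rw [lintegral_add_right _ measurable_const, lintegral_const, measure_univ, mul_one,
              lintegral_const_mul' _ _ ENNReal.ofReal_ne_top]
            rfl
        _ ≤ ENNReal.ofReal (b / (b + c)) * 1 + ENNReal.ofReal (c / (b + c)) := by gcongr
        _ = 1 := by
            rw [mul_one, ← ENNReal.ofReal_add (by positivity) (by positivity), ← add_div,
              div_self hbc.ne', ENNReal.ofReal_one]
    -- Equality in the strictly convex mixture of `(f - y)⁺ / b` and `1 = c / c` forces these to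
    -- agree. Then `f` is a.e. constant and attains its essential supremum.
    · have heq : ∀ᵐ u ∂ν, f u = y + b := by
        filter_upwards [hall] with u hu
        by_contra hne
        have hneq : max (f u - y) 0 / b ≠ 1 := by
          intro h1
          rw [div_eq_one_iff_eq hb0.ne'] at h1
          rcases max_cases (f u - y) 0 with h2 | h2
          · exact hne (by linarith)
          · linarith
        have hs := hconv.2 (mem_Ici.2 (div_nonneg (hnn y u) hb0.le))
          (mem_Ici.2 zero_le_one) hneq (div_pos hb0 hbc) (div_pos hc0 hbc)
          (by field_simp)
        simp only [smul_eq_mul, mul_one] at hs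
        rw [hφ1, mul_one] at hs
        have e : b / (b + c) * (max (f u - y) 0 / b) + c / (b + c) =
            (max (f u - y) 0 + c) / (b + c) := by field_simp
        rw [e] at hs
        exact absurd hu ((hpt u).trans_lt hs).ne
      obtain ⟨u, hu, hu'⟩ := (heq.and (hsup (y + b) (heq.mono fun u hu => hu.le))).exists
      exact hu'.ne hu

end Shift

/-! ### The probability measure of a distortion function -/

namespace DistortionFunction

variable (g : DistortionFunction)

/-- The measure `μ_g` regarded as a measure on `[0,1]`. -/
noncomputable def unitMeasure : Measure ℝ := g.measure.restrict (Icc 0 1)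

theorem stieltjes_apply {x : ℝ} (hx : x ∈ Icc (0 : ℝ) 1) : g.stieltjes x = g ⟨x, hx⟩ := by
  change (if x < 0 then 0 else (g (projIcc 0 1 zero_le_one x) : ℝ)) = _
  rw [if_neg (not_lt.2 hx.1), projIcc_of_mem]

theorem leftLim_stieltjes_zero : Function.leftLim g.stieltjes 0 = 0 := by
  refine leftLim_eq_of_tendsto ?_
  refine tendsto_const_nhds.congr' ?_
  filter_upwards [self_mem_nhdsWithin] with x hx
  exact (if_pos hx).symm

instance : IsProbabilityMeasure g.unitMeasure := by
  refine ⟨?_⟩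
  rw [unitMeasure, Measure.restrict_apply_univ, measure, StieltjesFunction.measure_Icc,
    leftLim_stieltjes_zero, g.stieltjes_apply (right_mem_Icc.2 zero_le_one)]
  have : g ⟨1, right_mem_Icc.2 zero_le_one⟩ = 1 := g.map_one'
  rw [this]
  simp

theorem ae_pos (h0 : g 0 = 0) : ∀ᵐ u ∂g.unitMeasure, 0 < u := by
  have h1 : ∀ᵐ u ∂g.unitMeasure, u ∈ Icc (0 : ℝ) 1 := ae_restrict_mem measurableSet_Icc
  have h2 : ∀ᵐ u ∂g.unitMeasure, u ≠ 0 := by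
    refine ae_restrict_of_ae ?_
    rw [ae_iff]
    have : {u : ℝ | ¬ u ≠ 0} = {0} := by ext; simp
    rw [this, measure, StieltjesFunction.measure_singleton, leftLim_stieltjes_zero,
      g.stieltjes_apply (left_mem_Icc.2 zero_le_one)]
    have : g ⟨0, left_mem_Icc.2 zero_le_one⟩ = 0 := h0
    rw [this]
    simp
  filter_upwards [h1, h2] with u hu hu'
  exact lt_of_le_of_ne hu.1 hu'.symm

theorem unitMeasure_Ioc_ne_zero (h0 : g 0 = 0) (hpos : ∀ u, 0 < u → 0 < g u) {e : ℝ}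
    (he : 0 < e) (he1 : e ≤ 1) : g.unitMeasure (Ioc 0 e) ≠ 0 := by
  have hsub : Ioc 0 e ⊆ Icc (0 : ℝ) 1 := fun u hu => ⟨hu.1.le, hu.2.trans he1⟩
  rw [unitMeasure, Measure.restrict_eq_self _ hsub, measure, StieltjesFunction.measure_Ioc,
    g.stieltjes_apply (left_mem_Icc.2 zero_le_one), g.stieltjes_apply ⟨he.le, he1⟩]
  have h0' : g ⟨0, left_mem_Icc.2 zero_le_one⟩ = 0 := h0
  have h1 : 0 < g ⟨e, he.le, he1⟩ := hpos _ he
  rw [h0', Ne, ENNReal.ofReal_eq_zero, not_le]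
  simpa using h1

end DistortionFunction

/-! ### Quantile functions -/

section Quantile

variable {Ω : Type*} [MeasurableSpace Ω] {P : Measure Ω} {X : Ω → ℝ}

/-- Right-continuity of the distribution function puts the infimum in the set when it is real. The
quantile facts below go through this Galois connection. -/
theorem quantile_le_coe_iff {v x : ℝ} : quantile P X v ≤ x ↔ v ≤ cdf (P.map X) x := by
  constructor
  · intro h
    have hy : ∀ y, x < y → v ≤ cdf (P.map X) y := by
      intro y hxy
      have : quantile P X v < y := h.trans_lt (EReal.coe_lt_coe_iff.2 hxy)
      obtain ⟨_, ⟨z, hz, rfl⟩, hzy⟩ := sInf_lt_iff.1 this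
      exact (show v ≤ cdf (P.map X) z from hz).trans (monotone_cdf _ (EReal.coe_lt_coe_iff.1 hzy).le)
    have hlim : Tendsto (cdf (P.map X)) (𝓝[>] x) (𝓝 (cdf (P.map X) x)) :=
      ((cdf (P.map X)).right_continuous x).mono_left (nhdsWithin_mono x Ioi_subset_Ici_self)
    refine ge_of_tendsto hlim ?_
    filter_upwards [self_mem_nhdsWithin] with y hxy using hy y hxy
  · exact fun h => sInf_le ⟨x, h, rfl⟩

theorem quantile_mono : Monotone (quantile P X) := by
  intro v w hvw
  refine EReal.le_of_forall_lt_iff_le.1 fun z hz => ?_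
  exact quantile_le_coe_iff.2 (hvw.trans (quantile_le_coe_iff.1 hz.le))

theorem quantile_of_nonpos {v : ℝ} (hv : v ≤ 0) : quantile P X v = ⊥ := by
  refine (EReal.eq_bot_iff_forall_lt _).2 fun y => ?_
  have h : quantile P X v ≤ ((y - 1 : ℝ) : EReal) :=
    quantile_le_coe_iff.2 (hv.trans (cdf_nonneg _ _))
  exact h.trans_lt (EReal.coe_lt_coe_iff.2 (by linarith))

theorem cdf_map_eq [IsProbabilityMeasure P] (hX : Measurable X) (x : ℝ) :
    cdf (P.map X) x = P.real {ω | X ω ≤ x} := by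
  have := Measure.isProbabilityMeasure_map (μ := P) hX.aemeasurable
  rw [cdf_eq_real, map_measureReal_apply hX measurableSet_Iic]
  rfl

theorem quantile_shift [IsProbabilityMeasure P] (hX : Measurable X) {v : ℝ} (hv : 0 < v)
    {x y : ℝ} (hy : quantile P X v = y) :
    quantile P (fun ω => max (X ω - x) 0) v = ((max (y - x) 0 : ℝ) : EReal) := by
  have hm : Measurable fun ω => max (X ω - x) 0 := (hX.sub_const x).max measurable_const
  have key : ∀ z : ℝ, quantile P (fun ω => max (X ω - x) 0) v ≤ z ↔ max (y - x) 0 ≤ z := by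
    intro z
    rw [quantile_le_coe_iff, cdf_map_eq hm]
    -- For `z < 0` the distribution function of the positive part vanishes, which is below `v`
    -- precisely because `v > 0`; at level 0 the quantile would be `⊥`.
    rcases lt_or_ge z 0 with hz | hz
    · have : {ω | max (X ω - x) 0 ≤ z} = ∅ := by
        ext ω
        simp [hz]
      rw [this, measureReal_empty]
      exact iff_of_false hv.not_ge fun h => (h.trans_lt hz).not_ge (le_max_right _ _)
    · have : {ω | max (X ω - x) 0 ≤ z} = {ω | X ω ≤ z + x} := by
        ext ω
        simp [hz]
      rw [this, ← cdf_map_eq hX, ← quantile_le_coe_iff, hy, EReal.coe_le_coe_iff, max_le_iff,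
        sub_le_iff_le_add]
      simp [hz]
  refine le_antisymm ((key _).2 le_rfl) (EReal.le_of_forall_lt_iff_le.1 fun z hz => ?_)
  exact EReal.coe_le_coe_iff.2 ((key z).1 hz.le)

/-- The real-valued version of `u ↦ F_X⁻¹ (1 - u)`. -/
noncomputable def upperQuantile (P : Measure Ω) (X : Ω → ℝ) (u : ℝ) : ℝ :=
  (quantile P X (1 - u)).toReal

theorem measurable_quantile_one_sub : Measurable fun u => quantile P X (1 - u) := by
  have h : Antitone fun u => quantile P X (1 - u) := fun u v huv =>
    quantile_mono (sub_le_sub_left huv 1)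
  exact h.measurable

theorem measurable_upperQuantile : Measurable (upperQuantile P X) :=
  measurable_quantile_one_sub.ereal_toReal

/-- The hypothesis on `X` passes to its quantile: `f ≤ k` a.e. gives `X ≤ k` a.s., then `X < k`
a.s., so `F_X` has left limit 1 at `k`, which rules out `f u ≥ k` for `u > 0`. -/
theorem ae_lt_of_ae_le_upperQuantile [IsProbabilityMeasure P] (hX : Measurable X)
    {g : DistortionFunction} (h0 : g 0 = 0) (hpos : ∀ u, 0 < u → 0 < g u)
    (hess : P {ω | (X ω : EReal) = essSup (fun ω' => (X ω' : EReal)) P} = 0)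
    (hfin : ∀ᵐ u ∂g.unitMeasure, quantile P X (1 - u) = upperQuantile P X u)
    {k : ℝ} (hk : ∀ᵐ u ∂g.unitMeasure, upperQuantile P X u ≤ k) :
    ∀ᵐ u ∂g.unitMeasure, upperQuantile P X u < k := by
  have := Measure.isProbabilityMeasure_map (μ := P) hX.aemeasurable
  have hF : cdf (P.map X) k = 1 := by
    refine le_antisymm (cdf_le_one _ _) (le_of_forall_pos_le_add fun e he => ?_)
    have he' : 0 < min e 1 := lt_min he one_pos
    -- As `g > 0` on `(0,1]`, `μ_g` charges every interval `(0, e]`, so the a.e. bound holds at some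
    -- arbitrarily small `u`.
    obtain ⟨u, hu, hu1, hu2⟩ := ((frequently_ae_mem_iff.2
      (g.unitMeasure_Ioc_ne_zero h0 hpos he' (min_le_right _ _))).and_eventually
        (hfin.and hk)).exists
    have hq : 1 - u ≤ cdf (P.map X) k := by
      rw [← quantile_le_coe_iff, hu1]
      exact EReal.coe_le_coe_iff.2 hu2
    linarith [hu.2, min_le_left e 1]
  have hle : ∀ᵐ ω ∂P, X ω ≤ k := by
    rw [cdf_map_eq hX] at hF
    have h1 : P {ω | X ω ≤ k} = 1 := by
      rwa [measureReal_def, ENNReal.toReal_eq_one_iff] at hF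
    exact (prob_compl_eq_zero_iff (measurableSet_le hX measurable_const)).2 h1
  have hlt : ∀ᵐ ω ∂P, X ω < k := by
    have hS : essSup (fun ω' => (X ω' : EReal)) P ≤ k :=
      essSup_le_of_ae_le _ (hle.mono fun ω hω => EReal.coe_le_coe_iff.2 hω)
    have hne : ∀ᵐ ω ∂P, (X ω : EReal) ≠ essSup (fun ω' => (X ω' : EReal)) P := by
      rw [ae_iff]
      simpa using hess
    filter_upwards [ae_le_essSup (f := fun ω' => (X ω' : EReal)) (μ := P), hne] with ω h1 h2
    exact EReal.coe_lt_coe_iff.1 ((lt_of_le_of_ne h1 h2).trans_le hS)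
  have hleft : Function.leftLim (cdf (P.map X)) k = 1 := by
    have h1 : P.map X (Iio k) = 1 := by
      rw [Measure.map_apply hX measurableSet_Iio]
      exact (prob_compl_eq_zero_iff (hX measurableSet_Iio)).1 hlt
    rw [← measure_cdf (P.map X), StieltjesFunction.measure_Iio _ (tendsto_cdf_atBot _), sub_zero,
      ENNReal.ofReal_eq_one] at h1
    exact h1
  filter_upwards [g.ae_pos h0, hfin] with u hu hq
  by_contra! hku
  have hz : ∀ z, z < k → cdf (P.map X) z ≤ 1 - u := by
    intro z hz
    by_contra! hlt'
    have := quantile_le_coe_iff.2 hlt'.le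
    rw [hq, EReal.coe_le_coe_iff] at this
    linarith
  have hlim := (monotone_cdf (P.map X)).tendsto_leftLim k
  rw [hleft] at hlim
  have := le_of_tendsto hlim (by
    filter_upwards [self_mem_nhdsWithin] with z hzk using hz z hzk)
  linarith

end Quantile

/-! ### From Orlicz-Lorentz premiums to Luxemburg norms -/

section Modular

variable {Ω : Type*} [MeasurableSpace Ω] {P : Measure Ω} {X : Ω → ℝ} {g : DistortionFunction}
  {φ : ℝ → ℝ}

theorem orliczLorentzModular_eq {f : ℝ → ℝ} {a : ℝ} (ha : 0 < a)
    (h : ∀ᵐ u ∂g.unitMeasure, quantile P X (1 - u) = f u) :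
    orliczLorentzModular P g φ X a = luxemburgModular g.unitMeasure φ (fun u => |f u|) a := by
  refine lintegral_congr_ae ?_
  filter_upwards [h] with u hu
  rw [hu, EReal.abs_def, ← ENNReal.ofReal_div_of_pos ha, youngExtend,
    if_neg ENNReal.ofReal_ne_top, ENNReal.toReal_ofReal (by positivity)]

/-- A finite modular excludes infinite quantiles a.e., because `φ ∞ = ∞`. This also gives `u < 1`,
as the quantile at a level `1 - u ≤ 0` is `⊥`. -/
theorem ae_quantile_eq_upperQuantile (hφ : IsYoungFunction φ)
    (hX : X ∈ orliczLorentzSpace P g φ) :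
    ∀ᵐ u ∂g.unitMeasure, u < 1 ∧ quantile P X (1 - u) = upperQuantile P X u := by
  obtain ⟨-, a, ha, hfin⟩ := hX
  have habs : Measurable EReal.abs := by
    refine EReal.measurable_of_measurable_real ?_
    exact measurable_id.abs.ennreal_ofReal
  have hm : Measurable fun u =>
      youngExtend φ ((quantile P X (1 - u)).abs / ENNReal.ofReal a) :=
    hφ.monotone_youngExtend.measurable.comp
      ((habs.comp measurable_quantile_one_sub).div_const _)
  filter_upwards [ae_lt_top hm hfin.ne] with u hu
  have habs' : (quantile P X (1 - u)).abs ≠ ∞ := by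
    intro h
    rw [h, ENNReal.top_div_of_ne_top ENNReal.ofReal_ne_top, youngExtend, if_pos rfl] at hu
    exact lt_irrefl _ hu
  have hbot : quantile P X (1 - u) ≠ ⊥ := fun h => habs' (by rw [h]; rfl)
  refine ⟨?_, (EReal.coe_toReal (fun h => habs' (by rw [h]; rfl)) hbot).symm⟩
  by_contra! h1
  exact hbot (quantile_of_nonpos (by linarith))

theorem orliczLorentzModular_shift [IsProbabilityMeasure P] (hφ : IsYoungFunction φ)
    (hX : X ∈ orliczLorentzSpace P g φ) (x : ℝ) {a : ℝ} (ha : 0 < a) :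
    orliczLorentzModular P g φ (fun ω => max (X ω - x) 0) a =
      luxemburgModular g.unitMeasure φ (fun u => max (upperQuantile P X u - x) 0) a := by
  rw [orliczLorentzModular_eq (f := fun u => max (upperQuantile P X u - x) 0) ha]
  · simp only [abs_of_nonneg (le_max_right _ (0 : ℝ))]
  · filter_upwards [ae_quantile_eq_upperQuantile hφ hX] with u hu
    exact quantile_shift hX.1 (sub_pos.2 hu.1) hu.2

theorem orliczLorentzPremium_shift [IsProbabilityMeasure P] (hφ : IsYoungFunction φ)
    (hX : X ∈ orliczLorentzSpace P g φ) (x : ℝ) :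
    orliczLorentzPremium P g φ 0 (fun ω => max (X ω - x) 0) =
      luxemburgNorm g.unitMeasure φ (fun u => max (upperQuantile P X u - x) 0) := by
  unfold orliczLorentzPremium luxemburgNorm luxemburgSet
  congr 1
  ext a
  simp only [mem_ofPred_eq, sub_zero, ENNReal.ofReal_one]
  refine and_congr_right fun ha => ?_
  rw [orliczLorentzModular_shift hφ hX x ha]

theorem luxemburgSet_upperQuantile_nonempty (hφ : IsYoungFunction φ)
    (hX : X ∈ orliczLorentzSpace P g φ) :
    (luxemburgSet g.unitMeasure φ fun u => |upperQuantile P X u|).Nonempty := by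
  obtain ⟨a, ha, hfin⟩ := hX.2
  refine luxemburgSet_nonempty hφ (fun u => abs_nonneg _) ha ?_
  rwa [← orliczLorentzModular_eq ha ((ae_quantile_eq_upperQuantile hφ hX).mono fun u hu => hu.2)]

end Modular

theorem proposition4 {Ω : Type*} [MeasurableSpace Ω] (P : Measure Ω) [IsProbabilityMeasure P]
    (g : DistortionFunction) (φ : ℝ → ℝ) (hφ : IsYoungFunction φ) (hφ1 : IsNormalized φ)
    (X : Ω → ℝ) (hX : X ∈ orliczLorentzSpace P g φ) :
    (∀ x : ℝ, (fun ω => max (X ω - x) 0) ∈ orliczLorentzSpace P g φ) ∧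
    Monotone (fun x : ℝ => orliczLorentzPremium P g φ 0 (fun ω => max (X ω - x) 0) + x) ∧
    Tendsto (fun x : ℝ => orliczLorentzPremium P g φ 0 (fun ω => max (X ω - x) 0) + x)
      atBot (𝓝 (distortionHG P g φ 0 X)) ∧
    (Continuous g → g 0 = 0 → (∀ u, 0 < u → 0 < g u) →
      StrictConvexOn ℝ (Ici 0) φ → SatisfiesDeltaTwo φ →
      P {ω | (X ω : EReal) = essSup (fun ω' => (X ω' : EReal)) P} = 0 →
      StrictMono (fun x : ℝ => orliczLorentzPremium P g φ 0 (fun ω => max (X ω - x) 0) + x) ∧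
      ¬ ∃ x : ℝ, orliczLorentzPremium P g φ 0 (fun ω => max (X ω - x) 0) + x
        = distortionHG P g φ 0 X) := by
  have hf : Measurable (upperQuantile P X) := measurable_upperQuantile
  have hne := luxemburgSet_upperQuantile_nonempty hφ hX
  have hmono := luxemburgNorm_shift_mono hφ hφ1 hf hne
  have hbdd := luxemburgNorm_shift_bddBelow hφ hφ1 hf hne
  unfold distortionHG
  simp only [orliczLorentzPremium_shift hφ hX]
  refine ⟨fun x => ⟨(hX.1.sub_const x).max measurable_const, ?_⟩, hmono,
    tendsto_atBot_ciInf hmono hbdd, fun _ h0 hpos hconv hΔ hess => ?_⟩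
  · obtain ⟨a, ha, ha1⟩ := luxemburgSet_shift_nonempty hφ hφ1 hf hne x
    refine ⟨a, ha, ?_⟩
    rw [orliczLorentzModular_shift hφ hX x ha]
    exact ha1.trans_lt ENNReal.one_lt_top
  · have hstrict := luxemburgNorm_shift_strictMono hφ hφ1 hf hne hconv hΔ fun k hk =>
      ae_lt_of_ae_le_upperQuantile hX.1 h0 hpos hess
        ((ae_quantile_eq_upperQuantile hφ hX).mono fun u hu => hu.2) hk
    refine ⟨hstrict, ?_⟩
    rintro ⟨x, hx⟩
    -- A minimum at `x` would be undercut at `x - 1`.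
    have h1 := hstrict (sub_one_lt x)
    have h2 := ciInf_le hbdd (x - 1)
    dsimp only at h1 h2
    linarith
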